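/- Let $m_1,\dots,m_n\in\mathbb C$ be masses such that $\sum_{k\in I}m_k\neq 0$ for every nonempty $I\subset\{1,\dots,n\}$. A *normalized central configuration* is a tuple of complex numbers $x_k,y_k$ ($1\le k\le n$) and $\delta_{kl}=\delta_{lk}$ ($k\ne l$) with $$x_k=\sum_{l\ne k}m_l\delta_{lk}^3(x_k-x_l),\quad y_k=\sum_{l\ne k}m_l\delta_{lk}^3(y_k-y_l)\quad(1\le k\le n),$$ $$\delta_{kl}^2\big((x_k-x_l)^2+(y_k-y_l)^2\big)=1\quad(k<l),\qquad y_1=y_2\ \text{(void if } n=1).$$ Put $z_k=x_k+iy_k$, $w_k=x_k-iy_k$, $Z_{lk}=\delta_{lk}^3(z_k-z_l)$, $W_{lk}=\delta_{lk}^3(w_k-w_l)$, $\mathcal Z=(z_1,\dots,z_n,Z_{12},\dots,Z_{(n-1)n})$ and $\mathcal W=(w_1,\dots,w_n,W_{12},\dots,W_{(n-1)n})$, with $\|\cdot\|$ the maximum of the absolute values of the entries. A *singular sequence* is a sequence of normalized central configurations such that $\|\mathcal Z\|$ is attained at the same entry of $\mathcal Z$ along the whole sequence, likewise for $\mathcal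 W$, such that $\|\mathcal Z\|^{-1}\mathcal Z$ and $\|\mathcal W\|^{-1}\mathcal W$ converge, and such that at least one of $\mathcal Z,\mathcal W$ is unbounded. For each term of such a sequence multiply the $z_k$ by $a>0$ and the $w_k$ by $a^{-1}$ (so that $\mathcal Z,\mathcal W$ are multiplied by $a$, $a^{-1}$), with $a$ chosen so that $\|\mathcal Z\|=\|\mathcal W\|$, and write $\|\mathcal Z\|=\|\mathcal W\|=\epsilon^{-2}$, $\epsilon>0$. For sequences, $u\approx v$ means that $u$ and $v$ are each bounded by a constant times the other from some term on. The *$z$-matrix* of the singular sequence is the symmetric $n\times n$ matrix $A=(a_{ij})$ with entries in $\{0,1\}$ such that $a_{ii}=1$ if and only if $z_i\approx\epsilon^{-2}$, and, for $i\neq j$, $a_{ij}=1$ if and only if $Z_{ij}\approx\epsilon^{-2}$. The *$w$-matrix* $B=(b_{ij})$ is defined in the same way from $w_i$ and $W_{ij}$. Let $C=(c_{ij})=A+B$. **Theorem.** Let $A$ and $B$ be the $z$-matrix and the $w$-matrix of a singular sequence. Then: (a) $\operatorname{tr}(A)\neq 1$. (b) If $c_{ij}\neq 1$ for all $1\le i<j\le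 n$, then $\operatorname{tr}(C)=0$. (c) If $\operatorname{tr}(A)=2$ and $a_{ii}=a_{jj}=1$ for some $i\neq j$, then $a_{ij}=1$ and $a_{ik}=a_{jk}$ for every $k\neq i,j$. (d) Suppose $\operatorname{tr}(A)=2$, $a_{ii}=a_{jj}=1$ for some $i\neq j$, and $a_{kl}=0$ whenever $k\ne l$ and $\{k,l\}\neq\{i,j\}$. Then $b_{ik}=b_{jk}=0$ for every $k\in\{1,\dots,n\}$. If moreover $m_i^3+m_j^3\neq 0$, then $\operatorname{tr}(B)\neq n-3$. (e) Suppose $\operatorname{tr}(A)=3$ and $a_{ii}=a_{jj}=a_{kk}=1$ for distinct $i,j,k$. If $l\notin\{i,j,k\}$ and $a_{ij}=a_{ik}=a_{il}=1$, then $a_{jl}+a_{kl}\neq 0$. All these statements also hold with $A$ and $B$ interchanged. -/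

import Mathlib

open scoped BigOperators Asymptotics

namespace PlanarNBody

/-- A point `(x, y, δ)` of `ℂ^{2n} × ℂ^{n(n-1)/2}`. The coordinate `δ s(k, l)`, `k ≠ l`, stands for
`1 / r_{kl}`; the values of `δ` on the diagonal are never used. -/
structure Configuration (n : ℕ) where
  x : Fin n → ℂ
  y : Fin n → ℂ
  δ : Sym2 (Fin n) → ℂ

/-- No nonempty subsystem has total mass zero. -/
def AdmissibleMasses {n : ℕ} (m : Fin n → ℂ) : Prop :=
  ∀ I : Finset (Fin n), I.Nonempty → ∑ k ∈ I, m k ≠ 0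

/-- Normalized central configurations: solutions of the polynomial system
`x_k = ∑_{l ≠ k} m_l δ_{lk}³ (x_k - x_l)`, `y_k = ∑_{l ≠ k} m_l δ_{lk}³ (y_k - y_l)`,
`1 = δ_{kl}² ((x_k - x_l)² + (y_k - y_l)²)`, `y_1 = y_2`.
The first two bodies have the indices `0` and `1` in `Fin n`. -/
structure IsNormalizedCC {n : ℕ} (m : Fin n → ℂ) (Q : Configuration n) : Prop where
  eq_x : ∀ k, Q.x k = ∑ l ∈ Finset.univ.erase k, m l * Q.δ s(l, k) ^ 3 * (Q.x k - Q.x l)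
  eq_y : ∀ k, Q.y k = ∑ l ∈ Finset.univ.erase k, m l * Q.δ s(l, k) ^ 3 * (Q.y k - Q.y l)
  eq_δ : ∀ k l, k < l →
    1 = Q.δ s(k, l) ^ 2 * ((Q.x k - Q.x l) ^ 2 + (Q.y k - Q.y l) ^ 2)
  eq_rot : ∀ k l : Fin n, k.val = 0 → l.val = 1 → Q.y l - Q.y k = 0

namespace Configuration

variable {n : ℕ}

/-- `z_k = x_k + i y_k`. -/
noncomputable def z (Q : Configuration n) (k : Fin n) : ℂ := Q.x k + Complex.I * Q.y k

/-- `w_k = x_k - i y_k`. -/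
noncomputable def w (Q : Configuration n) (k : Fin n) : ℂ := Q.x k - Complex.I * Q.y k

/-- `Z_{lk} = r_{lk}^{-3} z_{lk}` with `z_{lk} = z_k - z_l`, that is `z_{lk}^{-1/2} w_{lk}^{-3/2}`
for the branch of the roots fixed by `δ_{lk}`. -/
noncomputable def Z (Q : Configuration n) (l k : Fin n) : ℂ := Q.δ s(l, k) ^ 3 * (Q.z k - Q.z l)

/-- `W_{lk} = r_{lk}^{-3} w_{lk}` with `w_{lk} = w_k - w_l`, that is `z_{lk}^{-3/2} w_{lk}^{-1/2}`
for the branch of the roots fixed by `δ_{lk}`. -/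
noncomputable def W (Q : Configuration n) (l k : Fin n) : ℂ := Q.δ s(l, k) ^ 3 * (Q.w k - Q.w l)

end Configuration

/-- Index set of size `n (n + 1) / 2`: the bodies and the pairs `k < l`. -/
abbrev VecIndex (n : ℕ) : Type := Fin n ⊕ {p : Fin n × Fin n // p.1 < p.2}

namespace Configuration

variable {n : ℕ}

/-- The vector `(z_1, …, z_n, Z_{12}, …, Z_{(n-1)n})`. Its norm in Mathlib is the maximum of the
absolute values of the entries. -/
noncomputable def zVec (Q : Configuration n) : VecIndex n → ℂ :=
  Sum.elim Q.z (fun p => Q.Z p.1.1 p.1.2)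

/-- The vector `(w_1, …, w_n, W_{12}, …, W_{(n-1)n})`. -/
noncomputable def wVec (Q : Configuration n) : VecIndex n → ℂ :=
  Sum.elim Q.w (fun p => Q.W p.1.1 p.1.2)

/-- The positive factor `a` with `‖a • zVec‖ = ‖a⁻¹ • wVec‖`: the `z_k` (hence the `Z_{kl}`) are
multiplied by `a`, the `w_k` (hence the `W_{kl}`) by `a⁻¹`, and the `δ_{kl}` are unchanged. -/
noncomputable def scale (Q : Configuration n) : ℝ := Real.sqrt (‖Q.wVec‖ / ‖Q.zVec‖)

/-- The number `ε` such that the common value of `‖a • zVec‖` and `‖a⁻¹ • wVec‖` is `ε⁻²`. -/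
noncomputable def eps (Q : Configuration n) : ℝ := (‖Q.zVec‖ * ‖Q.wVec‖) ^ (-(1 / 4) : ℝ)

end Configuration

/-- Singular sequences: sequences of normalized central configurations along which a fixed entry
of each of the two vectors realizes its norm, the two normalized vectors converge, and at least
one of the two vectors is unbounded. -/
structure IsSingularSequence {n : ℕ} (m : Fin n → ℂ) (Q : ℕ → Configuration n) : Prop where
  isNormalizedCC : ∀ t, IsNormalizedCC m (Q t)
  max_z : ∃ p, ∀ t, ‖(Q t).zVec‖ = ‖(Q t).zVec p‖
  max_w : ∃ q, ∀ t, ‖(Q t).wVec‖ = ‖(Q t).wVec q‖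
  conv_z : ∃ v, Filter.Tendsto (fun t => ‖(Q t).zVec‖⁻¹ • (Q t).zVec) Filter.atTop (nhds v)
  conv_w : ∃ v, Filter.Tendsto (fun t => ‖(Q t).wVec‖⁻¹ • (Q t).wVec) Filter.atTop (nhds v)
  unbounded : ¬ Bornology.IsBounded (Set.range fun t => (Q t).zVec) ∨
    ¬ Bornology.IsBounded (Set.range fun t => (Q t).wVec)

section Diagram

variable {n : ℕ} (Q : ℕ → Configuration n)

/-- There is a `z`-circle at `k`: `z_k ≈ ε⁻²` in the balanced normalization. -/
def ZCircle (k : Fin n) : Prop :=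
  (fun t => (Q t).scale • (Q t).z k) =Θ[Filter.atTop] fun t => (Q t).eps ^ (-2 : ℤ)

/-- There is a `z`-stroke between `k` and `l`: `Z_{kl} ≈ ε⁻²` in the balanced normalization. -/
def ZStroke (k l : Fin n) : Prop :=
  (fun t => (Q t).scale • (Q t).Z k l) =Θ[Filter.atTop] fun t => (Q t).eps ^ (-2 : ℤ)

/-- There is a `w`-circle at `k`: `w_k ≈ ε⁻²` in the balanced normalization. -/
def WCircle (k : Fin n) : Prop :=
  (fun t => (Q t).scale⁻¹ • (Q t).w k) =Θ[Filter.atTop] fun t => (Q t).eps ^ (-2 : ℤ)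

/-- There is a `w`-stroke between `k` and `l`: `W_{kl} ≈ ε⁻²` in the balanced normalization. -/
def WStroke (k l : Fin n) : Prop :=
  (fun t => (Q t).scale⁻¹ • (Q t).W k l) =Θ[Filter.atTop] fun t => (Q t).eps ^ (-2 : ℤ)

open Classical in
/-- The `z`-matrix: adjacency matrix of the `z`-diagram, with `z`-circles as self-loops. -/
noncomputable def zMatrix : Matrix (Fin n) (Fin n) ℤ :=
  Matrix.of fun i j =>
    if i = j then (if ZCircle Q i then 1 else 0) else (if ZStroke Q i j then 1 else 0)

open Classical in
/-- The `w`-matrix: adjacency matrix of the `w`-diagram, with `w`-circles as self-loops. -/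
noncomputable def wMatrix : Matrix (Fin n) (Fin n) ℤ :=
  Matrix.of fun i j =>
    if i = j then (if WCircle Q i then 1 else 0) else (if WStroke Q i j then 1 else 0)

end Diagram

end PlanarNBody

open Filter Topology Asymptotics

/-! ### Asymptotics of balanced sequences. -/

namespace PlanarNBody

/-! In the balanced normalization, divide everything by the common norm `N`. The limits `ζ`, `ω`,
`Ξ`, `Ω` exist, and circles and strokes are exactly the nonzero limits. Put `z_{kl} = z_k - z_l`,
`w_{kl} = w_k - w_l`. Two mechanisms carry the proof.

Summing the equations over a set closed under `z`-strokes gives `∑ m_k ζ_k = 0`, because internal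
forces cancel (`sum_mass_mul_eq_zero`). And `d² z_{kl} w_{kl} = 1` gives `Z² z_{kl} w_{kl}³ = 1`,
hence `(N w_{kl})⁻³ → Ξ² (ζ_k - ζ_l)` (`tendsto_inv_pow_three`). So boundedness of `N w_{kl}` forces
a `z`-stroke, and the converse holds when `ζ_k ≠ ζ_l`. Moreover a `w`-stroke forces `ζ_k = ζ_l`.

(a) is the centre of mass. (b): each class of `z`-close bodies is closed under strokes, so its total
mass times the common `ζ` vanishes. (c): the two circled bodies are isolated, so `N w_i` and `N w_j`
are bounded. (e): with no stroke from `j` or `k` to `l`, the bodies `i`, `j`, `k` would be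
`z`-close, against the centre of mass. The mass relation in (d) comes from a torque balance: exactly
one further body `k` has `ω_k = 0`, and the torques on it from `i` and `j` dominate all others. They
must cancel, so `m_i²/ζ_i = m_j²/ζ_j`; combine this with `m_i ζ_i + m_j ζ_j = 0`. -/

/-- A sequence of solutions of the central configuration system in the coordinates `z`, `w`,
together with the limits of the `z_k`, `Z_{lk}`, `w_k`, `W_{lk}` divided by a sequence `N` that
tends to infinity. -/
structure BalancedLimit {n : ℕ} (m : Fin n → ℂ) (N : ℕ → ℂ) (z w : ℕ → Fin n → ℂ)
    (d : ℕ → Fin n → Fin n → ℂ) (ζ ω : Fin n → ℂ) (Ξ Ω : Fin n → Fin n → ℂ) : Prop where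
  tendsto_N : Tendsto N atTop (Bornology.cobounded ℂ)
  d_symm : ∀ t k l, d t k l = d t l k
  eq_z : ∀ t k, z t k = ∑ l, m l * (d t l k ^ 3 * (z t k - z t l))
  eq_w : ∀ t k, w t k = ∑ l, m l * (d t l k ^ 3 * (w t k - w t l))
  eq_d : ∀ t k l, k ≠ l → d t l k ^ 2 * ((z t k - z t l) * (w t k - w t l)) = 1
  lim_z : ∀ k, Tendsto (fun t => z t k / N t) atTop (𝓝 (ζ k))
  lim_w : ∀ k, Tendsto (fun t => w t k / N t) atTop (𝓝 (ω k))
  lim_Z : ∀ l k, Tendsto (fun t => d t l k ^ 3 * (z t k - z t l) / N t) atTop (𝓝 (Ξ l k))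
  lim_W : ∀ l k, Tendsto (fun t => d t l k ^ 3 * (w t k - w t l) / N t) atTop (𝓝 (Ω l k))

theorem isBigO_one_of_pow {f : ℕ → ℂ} {p : ℕ} (hp : p ≠ 0)
    (h : (fun t => f t ^ p) =O[atTop] fun _ => (1 : ℂ)) : f =O[atTop] fun _ => (1 : ℂ) := by
  refine IsBigO.of_pow (n := p) hp ?_
  simpa [Pi.pow_def] using h

theorem sum_sum_eq_zero_of_antisymm {ι : Type*} (S : Finset ι) (f : ι → ι → ℂ)
    (hf : ∀ k l, f k l = -f l k) : ∑ k ∈ S, ∑ l ∈ S, f k l = 0 := by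
  have h : ∑ k ∈ S, ∑ l ∈ S, f k l = -∑ k ∈ S, ∑ l ∈ S, f k l := by
    conv_lhs => rw [Finset.sum_comm]
    simp_rw [← Finset.sum_neg_distrib]
    exact Finset.sum_congr rfl fun k _ => Finset.sum_congr rfl fun l _ => hf l k
  exact self_eq_neg.mp h

namespace BalancedLimit

variable {n : ℕ} {m : Fin n → ℂ} {N : ℕ → ℂ} {z w : ℕ → Fin n → ℂ}
  {d : ℕ → Fin n → Fin n → ℂ} {ζ ω : Fin n → ℂ} {Ξ Ω : Fin n → Fin n → ℂ}

theorem symm (h : BalancedLimit m N z w d ζ ω Ξ Ω) : BalancedLimit m N w z d ω ζ Ω Ξ where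
  tendsto_N := h.tendsto_N
  d_symm := h.d_symm
  eq_z := h.eq_w
  eq_w := h.eq_z
  eq_d t k l hkl := by rw [mul_comm (w t k - w t l)]; exact h.eq_d t k l hkl
  lim_z := h.lim_w
  lim_w := h.lim_z
  lim_Z := h.lim_W
  lim_W := h.lim_Z

variable (h : BalancedLimit m N z w d ζ ω Ξ Ω)
include h

theorem eventually_ne : ∀ᶠ t in atTop, N t ≠ 0 :=
  h.tendsto_N.eventually (Bornology.eventually_ne_cobounded 0)

theorem tendsto_inv : Tendsto (fun t => (N t)⁻¹) atTop (𝓝 0) :=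
  tendsto_inv₀_cobounded.comp h.tendsto_N

theorem lim_z_sub (k l : Fin n) :
    Tendsto (fun t => (z t k - z t l) / N t) atTop (𝓝 (ζ k - ζ l)) := by
  simpa only [sub_div] using (h.lim_z k).sub (h.lim_z l)

theorem sub_z_ne (t : ℕ) {k l : Fin n} (hkl : k ≠ l) : z t k - z t l ≠ 0 := by
  intro h0
  have := h.eq_d t k l hkl
  simp [h0] at this

theorem strokes_antisymm (k l : Fin n) : Ξ k l = -Ξ l k := by
  refine tendsto_nhds_unique (h.lim_Z k l) ?_
  refine (h.lim_Z l k).neg.congr fun t => ?_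
  rw [h.d_symm t k l]
  ring

theorem eq_zeta (k : Fin n) : ζ k = ∑ l, m l * Ξ l k := by
  refine tendsto_nhds_unique (h.lim_z k) ?_
  refine (tendsto_finsetSum _ fun l _ => (h.lim_Z l k).const_mul (m l)).congr fun t => ?_
  conv_rhs => rw [h.eq_z t k]
  rw [Finset.sum_div]
  exact Finset.sum_congr rfl fun l _ => by ring

/-- The centre of mass of a union of connected components of the `z`-diagram vanishes to leading
order. -/
theorem sum_mass_mul_eq_zero (S : Finset (Fin n)) (hS : ∀ k ∈ S, ∀ l ∉ S, Ξ l k = 0) :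
    ∑ k ∈ S, m k * ζ k = 0 := by
  -- Action and reaction cancel inside `S`, and `hS` removes the forces from outside.
  rw [← sum_sum_eq_zero_of_antisymm S (fun k l => m k * m l * Ξ l k)
    (fun k l => by rw [h.strokes_antisymm l k]; ring)]
  refine Finset.sum_congr rfl fun k hk => ?_
  rw [h.eq_zeta k, Finset.mul_sum]
  symm
  refine (Finset.sum_subset (Finset.subset_univ S) fun l _ hl => ?_).trans ?_
  · rw [hS k hk l hl, mul_zero]
  · exact Finset.sum_congr rfl fun l _ => by ring

theorem sum_mass_mul_univ : ∑ k, m k * ζ k = 0 :=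
  h.sum_mass_mul_eq_zero Finset.univ fun _ _ l hl => absurd (Finset.mem_univ l) hl

/-- This is `Z² z_{kl} w_{kl}³ = 1` divided by `(N w_{kl})³`. It converts information on strokes
into the size of `w_{kl}` at the scale `N⁻¹`, which `ω` does not see. -/
theorem tendsto_inv_pow_three {k l : Fin n} (hkl : k ≠ l) :
    Tendsto (fun t => ((N t * (w t k - w t l)) ^ 3)⁻¹) atTop
      (𝓝 (Ξ l k ^ 2 * (ζ k - ζ l))) := by
  refine (((h.lim_Z l k).pow 2).mul (h.lim_z_sub k l)).congr' ?_
  filter_upwards [h.eventually_ne] with t ht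
  have hw := h.symm.sub_z_ne t hkl
  have hd := h.eq_d t k l hkl
  field_simp
  linear_combination
    ((d t l k ^ 2 * ((z t k - z t l) * (w t k - w t l))) ^ 2
      + d t l k ^ 2 * ((z t k - z t l) * (w t k - w t l)) + 1) * hd

/-- A `w`-stroke joins bodies that are `z`-close. -/
theorem eq_of_stroke {k l : Fin n} (hΩ : Ω l k ≠ 0) : ζ k = ζ l := by
  by_cases hkl : k = l
  · rw [hkl]
  -- The exponents come from `z_{kl}⁸ W⁶ = Z²`, a consequence of `(d² z_{kl} w_{kl})⁶ = 1`. Dividing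
  -- by `N¹⁴` leaves a spare factor `N⁻¹²` on the right.
  have h1 : Tendsto (fun t => ((z t k - z t l) / N t) ^ 8 *
      (d t l k ^ 3 * (w t k - w t l) / N t) ^ 6) atTop (𝓝 ((ζ k - ζ l) ^ 8 * Ω l k ^ 6)) :=
    ((h.lim_z_sub k l).pow 8).mul ((h.lim_W l k).pow 6)
  have h2 : Tendsto (fun t => (d t l k ^ 3 * (z t k - z t l) / N t) ^ 2 * (N t)⁻¹ ^ 12) atTop
      (𝓝 (Ξ l k ^ 2 * 0 ^ 12)) := ((h.lim_Z l k).pow 2).mul (h.tendsto_inv.pow 12)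
  have h3 : (ζ k - ζ l) ^ 8 * Ω l k ^ 6 = Ξ l k ^ 2 * 0 ^ 12 := by
    refine tendsto_nhds_unique h1 (h2.congr' ?_)
    filter_upwards [h.eventually_ne] with t ht
    have hd : (d t l k ^ 2 * ((z t k - z t l) * (w t k - w t l))) ^ 6 = 1 := by
      rw [h.eq_d t k l hkl, one_pow]
    field_simp
    linear_combination (-d t l k ^ 6 * (z t k - z t l) ^ 2) * hd
  simpa [hΩ, sub_eq_zero] using h3

theorem isBigO_of_stroke {k l : Fin n} (hkl : ζ k ≠ ζ l) (hΞ : Ξ l k ≠ 0) :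
    (fun t => N t * (w t k - w t l)) =O[atTop] fun _ => (1 : ℂ) := by
  have hne : k ≠ l := fun e => hkl (by rw [e])
  refine isBigO_one_of_pow three_ne_zero ?_
  have := (h.tendsto_inv_pow_three hne).inv₀ (mul_ne_zero (pow_ne_zero 2 hΞ) (sub_ne_zero.mpr hkl))
  simp only [inv_inv] at this
  exact this.isBigO_one ℂ

theorem stroke_of_isBigO {k l : Fin n} (hkl : k ≠ l)
    (hw : (fun t => N t * (w t k - w t l)) =O[atTop] fun _ => (1 : ℂ)) : Ξ l k ≠ 0 := by
  intro h0
  have h1 := h.tendsto_inv_pow_three hkl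
  rw [h0, zero_pow two_ne_zero, zero_mul] at h1
  have h2 : Tendsto (fun t => ((N t * (w t k - w t l)) ^ 3)⁻¹ * (N t * (w t k - w t l)) ^ 3)
      atTop (𝓝 0) := by
    have h3 := ((isLittleO_one_iff ℂ).mpr h1).mul_isBigO (hw.pow 3)
    simpa only [one_pow, mul_one, isLittleO_one_iff] using h3
  have h3 : Tendsto (fun _ : ℕ => (1 : ℂ)) atTop (𝓝 0) := by
    refine h2.congr' ?_
    filter_upwards [h.eventually_ne] with t ht
    exact inv_mul_cancel₀ (pow_ne_zero 3 (mul_ne_zero ht (h.symm.sub_z_ne t hkl)))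
  exact one_ne_zero (tendsto_nhds_unique tendsto_const_nhds h3)

/-- Since `W² = z_{kl}⁻³ w_{kl}⁻¹`, one has `(N W)⁶ = (N w_{kl})⁻³ (z_{kl}/N)⁻⁹`, and both factors
converge. -/
theorem isBigO_mul_force {k l : Fin n} (hkl : ζ k ≠ ζ l) :
    (fun t => N t * (d t l k ^ 3 * (w t k - w t l))) =O[atTop] fun _ => (1 : ℂ) := by
  have hne : k ≠ l := fun e => hkl (by rw [e])
  refine isBigO_one_of_pow (p := 6) (by norm_num) ?_
  have h1 := (h.tendsto_inv_pow_three hne).mul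
    (((h.lim_z_sub k l).pow 9).inv₀ (pow_ne_zero 9 (sub_ne_zero.mpr hkl)))
  refine (h1.congr' ?_).isBigO_one ℂ
  filter_upwards [h.eventually_ne] with t ht
  have hw := h.symm.sub_z_ne t hne
  have hz := h.sub_z_ne t hne
  have hd : (d t l k ^ 2 * ((z t k - z t l) * (w t k - w t l))) ^ 9 = 1 := by
    rw [h.eq_d t k l hne, one_pow]
  field_simp
  linear_combination -hd

/-- A body that is not `z`-close to any other has a small coordinate `w`. -/
theorem isBigO_mul_of_isolated {i : Fin n} (hi : ∀ k, k ≠ i → ζ i ≠ ζ k) :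
    (fun t => N t * w t i) =O[atTop] fun _ => (1 : ℂ) := by
  -- In the equation for `w_i` every force on `i` is `O(N⁻¹)`.
  have h1 : (fun t => ∑ k, m k * (N t * (d t k i ^ 3 * (w t i - w t k)))) =O[atTop]
      fun _ => (1 : ℂ) := by
    refine IsBigO.fun_sum fun k _ => IsBigO.const_mul_left ?_ _
    by_cases hk : k = i
    · simp only [hk, sub_self, mul_zero]
      exact isBigO_zero (fun _ : ℕ => (1 : ℂ)) atTop
    · exact h.isBigO_mul_force (hi k hk)
  refine h1.congr_left fun t => ?_
  conv_rhs => rw [h.eq_w t i, Finset.mul_sum]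
  exact Finset.sum_congr rfl fun k _ => by ring

theorem omega_eq_zero_of_isBigO {i : Fin n}
    (hi : (fun t => N t * w t i) =O[atTop] fun _ => (1 : ℂ)) : ω i = 0 := by
  refine tendsto_nhds_unique (h.lim_w i) ?_
  have h0 : Tendsto (fun t => (N t)⁻¹ ^ 2) atTop (𝓝 0) := by simpa using h.tendsto_inv.pow 2
  have h1 := ((isLittleO_one_iff ℂ).mpr h0).mul_isBigO hi
  simp only [mul_one, isLittleO_one_iff] at h1
  refine h1.congr' ?_
  filter_upwards [h.eventually_ne] with t ht
  field_simp

end BalancedLimit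

/-! ### Torque balance and the relation between two masses. -/

theorem tendsto_zero_of_pow {f : ℕ → ℂ} {p : ℕ} (hp : p ≠ 0)
    (h : Tendsto (fun t => f t ^ p) atTop (𝓝 0)) : Tendsto f atTop (𝓝 0) := by
  rw [← isLittleO_one_iff ℂ] at h ⊢
  refine IsLittleO.of_pow (n := p) ?_ hp
  simpa [Pi.pow_def] using h

theorem isBigO_mul_sub {N : ℕ → ℂ} {f g : ℕ → ℂ}
    (hf : (fun t => N t * f t) =O[atTop] fun _ => (1 : ℂ))
    (hg : (fun t => N t * g t) =O[atTop] fun _ => (1 : ℂ)) :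
    (fun t => N t * (f t - g t)) =O[atTop] fun _ => (1 : ℂ) :=
  (hf.sub hg).congr_left fun t => by ring

namespace BalancedLimit

variable {n : ℕ} {m : Fin n → ℂ} {N : ℕ → ℂ} {z w : ℕ → Fin n → ℂ}
  {d : ℕ → Fin n → Fin n → ℂ} {ζ ω : Fin n → ℂ} {Ξ Ω : Fin n → Fin n → ℂ}

variable (h : BalancedLimit m N z w d ζ ω Ξ Ω)
include h

/-- The torque exerted on the bodies of `S` by the other ones vanishes. -/
theorem torque_eq_zero (t : ℕ) (S : Finset (Fin n)) :
    ∑ l ∈ S, m l * ∑ p ∈ Sᶜ, m p *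
      (w t l * (d t p l ^ 3 * (z t l - z t p)) - z t l * (d t p l ^ 3 * (w t l - w t p))) = 0 := by
  have h1 := sum_sum_eq_zero_of_antisymm S (fun l p => m l * (m p *
      (w t l * (d t p l ^ 3 * (z t l - z t p)) - z t l * (d t p l ^ 3 * (w t l - w t p)))))
    (fun k l => by rw [h.d_symm t l k]; ring)
  simp_rw [← Finset.mul_sum] at h1
  refine (left_eq_add.mpr h1).trans ?_
  rw [← Finset.sum_add_distrib]
  refine Finset.sum_eq_zero fun l _ => ?_
  rw [← mul_add, add_comm, Finset.sum_add_sum_compl]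
  -- The total force on `l` is its own position, so its total torque vanishes.
  have h2 : ∑ p, m p * (w t l * (d t p l ^ 3 * (z t l - z t p)) -
      z t l * (d t p l ^ 3 * (w t l - w t p))) = w t l * z t l - z t l * w t l := by
    conv_rhs => rw [← mul_one (w t l * z t l), ← mul_one (z t l * w t l)]
    simp_rw [mul_sub (m _), Finset.sum_sub_distrib, mul_one]
    congr 1
    · conv_rhs => rw [h.eq_z t l, Finset.mul_sum]
      exact Finset.sum_congr rfl fun p _ => by ring
    · conv_rhs => rw [h.eq_w t l, Finset.mul_sum]
      exact Finset.sum_congr rfl fun p _ => by ring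
  rw [h2]
  ring

/-- Both separations are of order `N`, and `Z² = z_{lp}⁻¹ w_{lp}⁻³`. -/
theorem isBigO_sq_mul_force {l p : Fin n} (hζ : ζ l ≠ ζ p) (hω : ω l ≠ ω p) :
    (fun t => N t ^ 2 * (d t p l ^ 3 * (z t l - z t p))) =O[atTop] fun _ => (1 : ℂ) := by
  have hne : l ≠ p := fun e => hζ (by rw [e])
  refine isBigO_one_of_pow two_ne_zero ?_
  have h1 := ((h.lim_z_sub l p).inv₀ (sub_ne_zero.mpr hζ)).mul
    (((h.symm.lim_z_sub l p).pow 3).inv₀ (pow_ne_zero 3 (sub_ne_zero.mpr hω)))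
  refine (h1.congr' ?_).isBigO_one ℂ
  filter_upwards [h.eventually_ne] with t ht
  have hw := h.symm.sub_z_ne t hne
  have hz := h.sub_z_ne t hne
  have hd : (d t p l ^ 2 * ((z t l - z t p) * (w t l - w t p))) ^ 3 = 1 := by
    rw [h.eq_d t l p hne, one_pow]
  field_simp
  linear_combination -hd

theorem isBigO_torque {l p : Fin n} (hζ : ζ l ≠ ζ p) (hω : ω l ≠ ω p) :
    (fun t => N t * (w t l * (d t p l ^ 3 * (z t l - z t p)) -
      z t l * (d t p l ^ 3 * (w t l - w t p)))) =O[atTop] fun _ => (1 : ℂ) := by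
  have h1 := (((h.lim_w l).isBigO_one ℂ).mul (h.isBigO_sq_mul_force hζ hω)).sub
    (((h.lim_z l).isBigO_one ℂ).mul (h.symm.isBigO_sq_mul_force hω hζ))
  simp only [mul_one] at h1
  refine h1.congr' ?_ EventuallyEq.rfl
  filter_upwards [h.eventually_ne] with t ht
  field_simp

theorem tendsto_inv_mul_sub {k p : Fin n} (hkp : k ≠ p) (hΞ : Ξ p k = 0) :
    Tendsto (fun t => (N t * (w t k - w t p))⁻¹) atTop (𝓝 0) := by
  refine tendsto_zero_of_pow three_ne_zero ?_
  simpa only [hΞ, inv_pow, ne_eq, OfNat.ofNat_ne_zero, not_false_eq_true, zero_pow, zero_mul]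
    using h.tendsto_inv_pow_three hkp

/-- Without a `z`-stroke `N w_{kp}` tends to infinity while `N w_p` stays bounded, so `w_k`
dominates `w_p`. -/
theorem tendsto_div_sub {k p : Fin n} (hkp : k ≠ p) (hΞ : Ξ p k = 0)
    (hp : (fun t => N t * w t p) =O[atTop] fun _ => (1 : ℂ)) :
    Tendsto (fun t => w t k / (w t k - w t p)) atTop (𝓝 1) := by
  have h1 := ((isLittleO_one_iff ℂ).mpr (h.tendsto_inv_mul_sub hkp hΞ)).mul_isBigO hp
  simp only [mul_one, isLittleO_one_iff] at h1
  have h2 := h1.const_add 1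
  rw [add_zero] at h2
  refine h2.congr' ?_
  filter_upwards [h.eventually_ne] with t ht
  have hw := h.symm.sub_z_ne t hkp
  field_simp
  ring

/-- The factor `r`, a square root of `w_k / N`, brings this half of the torque to order one.
Squaring avoids the branch of the root hidden in `d³`. -/
theorem tendsto_main_force_sq {k p : Fin n} (hζ : ζ k ≠ ζ p) (hΞ : Ξ p k = 0)
    (hp : (fun t => N t * w t p) =O[atTop] fun _ => (1 : ℂ)) {r : ℕ → ℂ}
    (hr : ∀ t, r t ^ 2 = w t k / N t) :
    Tendsto (fun t => (N t * (w t k * (d t p k ^ 3 * (z t k - z t p))) * r t) ^ 2) atTop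
      (𝓝 (ζ k - ζ p)⁻¹) := by
  have hne : k ≠ p := fun e => hζ (by rw [e])
  have h1 := ((h.lim_z_sub k p).inv₀ (sub_ne_zero.mpr hζ)).mul
    ((h.tendsto_div_sub hne hΞ hp).pow 3)
  rw [one_pow, mul_one] at h1
  refine h1.congr' ?_
  filter_upwards [h.eventually_ne] with t ht
  have hw := h.symm.sub_z_ne t hne
  have hz := h.sub_z_ne t hne
  have hd : (d t p k ^ 2 * ((z t k - z t p) * (w t k - w t p))) ^ 3 = 1 := by
    rw [h.eq_d t k p hne, one_pow]
  rw [mul_pow, hr]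
  field_simp
  linear_combination (-w t k ^ 3) * hd

theorem tendsto_minor_force {k p : Fin n} (hζ : ζ k ≠ ζ p) (hk : ζ k = 0) (hΞ : Ξ p k = 0)
    (hp : (fun t => N t * w t p) =O[atTop] fun _ => (1 : ℂ)) {r : ℕ → ℂ}
    (hr : ∀ t, r t ^ 2 = w t k / N t) :
    Tendsto (fun t => N t * (z t k * (d t p k ^ 3 * (w t k - w t p))) * r t) atTop (𝓝 0) := by
  have hne : k ≠ p := fun e => hζ (by rw [e])
  refine tendsto_zero_of_pow two_ne_zero ?_
  have h1 := (((h.lim_z k).pow 2).mul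
    (((h.lim_z_sub k p).pow 3).inv₀ (pow_ne_zero 3 (sub_ne_zero.mpr hζ)))).mul
    (h.tendsto_div_sub hne hΞ hp)
  rw [hk, zero_pow two_ne_zero, zero_mul, zero_mul] at h1
  refine h1.congr' ?_
  filter_upwards [h.eventually_ne] with t ht
  have hw := h.symm.sub_z_ne t hne
  have hz := h.sub_z_ne t hne
  have hd : (d t p k ^ 2 * ((z t k - z t p) * (w t k - w t p))) ^ 3 = 1 := by
    rw [h.eq_d t k p hne, one_pow]
  rw [mul_pow, hr]
  field_simp
  linear_combination (-z t k ^ 2 * w t k) * hd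

/-- If `i`, `j` are the only `z`-circled bodies, without `z`-stroke to another body, and all other
bodies but one are `w`-circled, then the masses of `i` and `j` satisfy a relation. -/
theorem mass_cube_add_eq_zero {i j k : Fin n} (hij : i ≠ j) (hki : k ≠ i) (hkj : k ≠ j)
    (hi : ζ i ≠ 0) (hj : ζ j ≠ 0) (hζ : ∀ l, l ≠ i → l ≠ j → ζ l = 0)
    (hwi : (fun t => N t * w t i) =O[atTop] fun _ => (1 : ℂ))
    (hwj : (fun t => N t * w t j) =O[atTop] fun _ => (1 : ℂ))
    (hik : Ξ i k = 0) (hjk : Ξ j k = 0) (hk : ω k = 0)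
    (hω : ∀ l, l ≠ i → l ≠ j → l ≠ k → ω l ≠ 0) (hmk : m k ≠ 0) :
    m i ^ 3 + m j ^ 3 = 0 := by
  set T : ℕ → Fin n → Fin n → ℂ := fun t l p => w t l * (d t p l ^ 3 * (z t l - z t p)) -
    z t l * (d t p l ^ 3 * (w t l - w t p)) with hT
  have hζk : ζ k = 0 := hζ k hki hkj
  have hcm : m i * ζ i + m j * ζ j = 0 := by
    rw [← h.sum_mass_mul_univ, ← Finset.sum_pair (f := fun l => m l * ζ l) hij]
    refine Finset.sum_subset (Finset.subset_univ _) fun l _ hl => ?_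
    simp only [Finset.mem_insert, Finset.mem_singleton, not_or] at hl
    rw [hζ l hl.1 hl.2, mul_zero]
  have hpair (t : ℕ) : m k * (m i * T t k i + m j * T t k j) =
      -∑ l ∈ ({i, j}ᶜ : Finset (Fin n)).erase k, m l * (m i * T t l i + m j * T t l j) := by
    have h1 := h.torque_eq_zero t {i, j}ᶜ
    rw [compl_compl] at h1
    simp_rw [Finset.sum_pair hij] at h1
    rw [← Finset.add_sum_erase _ _ (a := k) (by simp [hki, hkj])] at h1
    exact eq_neg_of_add_eq_zero_left h1
  have hωi := h.omega_eq_zero_of_isBigO hwi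
  have hωj := h.omega_eq_zero_of_isBigO hwj
  -- Every remaining body is far from `i` and `j` in both coordinates, so its torques are `O(N⁻¹)`.
  have hbdd : (fun t => N t * (m i * T t k i + m j * T t k j)) =O[atTop] fun _ => (1 : ℂ) := by
    have h1 : (fun t => ∑ l ∈ ({i, j}ᶜ : Finset (Fin n)).erase k,
        (m l * m i * (N t * T t l i) + m l * m j * (N t * T t l j))) =O[atTop]
        fun _ => (1 : ℂ) := by
      refine IsBigO.fun_sum fun l hl => ?_
      simp only [Finset.mem_erase, Finset.mem_compl, Finset.mem_insert, Finset.mem_singleton,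
        not_or] at hl
      have hζl := hζ l hl.2.1 hl.2.2
      have hωl := hω l hl.2.1 hl.2.2 hl.1
      refine (IsBigO.const_mul_left ?_ _).add (IsBigO.const_mul_left ?_ _)
      · exact h.isBigO_torque (by rw [hζl]; exact hi.symm) (by rw [hωi]; exact hωl)
      · exact h.isBigO_torque (by rw [hζl]; exact hj.symm) (by rw [hωj]; exact hωl)
    refine (h1.const_mul_left (-(m k)⁻¹)).congr_left fun t => ?_
    have h2 : (m k)⁻¹ * (m k * (m i * T t k i + m j * T t k j)) =
        m i * T t k i + m j * T t k j := inv_mul_cancel_left₀ hmk _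
    rw [← h2, hpair, Finset.mul_sum, ← Finset.sum_neg_distrib, Finset.mul_sum, Finset.mul_sum]
    exact Finset.sum_congr rfl fun l _ => by ring
  choose r hr using fun t => IsAlgClosed.exists_pow_nat_eq (w t k / N t) two_pos
  have hr0 : Tendsto r atTop (𝓝 0) := by
    refine tendsto_zero_of_pow two_ne_zero ?_
    simp_rw [hr]
    rw [← hk]
    exact h.lim_w k
  have hζki : ζ k ≠ ζ i := by rw [hζk]; exact hi.symm
  have hζkj : ζ k ≠ ζ j := by rw [hζk]; exact hj.symm
  have hUi := h.tendsto_main_force_sq hζki hik hwi hr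
  have hUj := h.tendsto_main_force_sq hζkj hjk hwj hr
  have hVi := h.tendsto_minor_force hζki hζk hik hwi hr
  have hVj := h.tendsto_minor_force hζkj hζk hjk hwj hr
  set U : ℕ → Fin n → ℂ := fun t p =>
    N t * (w t k * (d t p k ^ 3 * (z t k - z t p))) * r t with hU
  have hsum : Tendsto (fun t => m i * U t i + m j * U t j) atTop (𝓝 0) := by
    have h1 := ((isLittleO_one_iff ℂ).mpr hr0).mul_isBigO hbdd
    simp only [mul_one, isLittleO_one_iff] at h1
    have h2 := (h1.add (hVi.const_mul (m i))).add (hVj.const_mul (m j))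
    simp only [mul_zero, add_zero] at h2
    refine h2.congr fun t => ?_
    simp only [hT, hU]
    ring
  -- Only the squares of the `U` are known to converge. Multiplying the vanishing sum by the bounded
  -- difference turns the cancellation into a relation between squares.
  have hdiff : (fun t => m i * U t i - m j * U t j) =O[atTop] fun _ => (1 : ℂ) :=
    ((isBigO_one_of_pow two_ne_zero (hUi.isBigO_one ℂ)).const_mul_left _).sub
      ((isBigO_one_of_pow two_ne_zero (hUj.isBigO_one ℂ)).const_mul_left _)
  have hprod := ((isLittleO_one_iff ℂ).mpr hsum).mul_isBigO hdiff
  simp only [mul_one, isLittleO_one_iff] at hprod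
  have hlim : m i ^ 2 * (ζ k - ζ i)⁻¹ - m j ^ 2 * (ζ k - ζ j)⁻¹ = 0 := by
    refine tendsto_nhds_unique ((hUi.const_mul (m i ^ 2)).sub (hUj.const_mul (m j ^ 2)))
      (hprod.congr fun t => ?_)
    ring
  rw [hζk, zero_sub, zero_sub] at hlim
  field_simp at hlim
  refine (mul_eq_zero.mp ?_).resolve_left hi
  linear_combination m j * hlim + m i ^ 2 * hcm

end BalancedLimit

/-! ### Matrices of nonvanishing limits. -/

open Classical in
/-- The `0`-`1` matrix of nonvanishing limits. -/
noncomputable def limitMatrix {n : ℕ} (ζ : Fin n → ℂ) (Ξ : Fin n → Fin n → ℂ) :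
    Matrix (Fin n) (Fin n) ℤ :=
  Matrix.of fun i j => if i = j then (if ζ i ≠ 0 then 1 else 0) else (if Ξ i j ≠ 0 then 1 else 0)

section limitMatrix

variable {n : ℕ} {ζ ω : Fin n → ℂ} {Ξ Ω : Fin n → Fin n → ℂ}

theorem limitMatrix_eq_zero_or_one (i j : Fin n) :
    limitMatrix ζ Ξ i j = 0 ∨ limitMatrix ζ Ξ i j = 1 := by
  simp only [limitMatrix, Matrix.of_apply]
  split_ifs <;> simp

theorem limitMatrix_diag_eq_one {i : Fin n} : limitMatrix ζ Ξ i i = 1 ↔ ζ i ≠ 0 := by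
  simp only [limitMatrix, Matrix.of_apply]
  split_ifs <;> simp_all

theorem limitMatrix_diag_eq_zero {i : Fin n} : limitMatrix ζ Ξ i i = 0 ↔ ζ i = 0 := by
  simp only [limitMatrix, Matrix.of_apply]
  split_ifs <;> simp_all

theorem limitMatrix_eq_one {i j : Fin n} (hij : i ≠ j) : limitMatrix ζ Ξ i j = 1 ↔ Ξ i j ≠ 0 := by
  simp only [limitMatrix, Matrix.of_apply]
  split_ifs <;> simp_all

theorem limitMatrix_eq_zero {i j : Fin n} (hij : i ≠ j) : limitMatrix ζ Ξ i j = 0 ↔ Ξ i j = 0 := by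
  simp only [limitMatrix, Matrix.of_apply]
  split_ifs <;> simp_all

open Classical in
theorem trace_limitMatrix :
    (limitMatrix ζ Ξ).trace = ((Finset.univ.filter fun i => ζ i ≠ 0).card : ℤ) := by
  simp [Matrix.trace, limitMatrix, Finset.sum_ite]

theorem eq_zero_of_trace_eq_card {S : Finset (Fin n)} (hS : ∀ i ∈ S, ζ i ≠ 0)
    (h : (limitMatrix ζ Ξ).trace = S.card) {l : Fin n} (hl : l ∉ S) : ζ l = 0 := by
  classical
  rw [trace_limitMatrix, Nat.cast_inj] at h
  have h1 : S = Finset.univ.filter fun i => ζ i ≠ 0 :=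
    Finset.eq_of_subset_of_card_le (fun i hi => by simpa using hS i hi) h.le
  rw [h1] at hl
  simpa using hl

end limitMatrix

/-! ### The matrix rules for balanced limits. -/

namespace BalancedLimit

variable {n : ℕ} {m : Fin n → ℂ} {N : ℕ → ℂ} {z w : ℕ → Fin n → ℂ}
  {d : ℕ → Fin n → Fin n → ℂ} {ζ ω : Fin n → ℂ} {Ξ Ω : Fin n → Fin n → ℂ}

variable (h : BalancedLimit m N z w d ζ ω Ξ Ω)
include h

theorem stroke_comm {k l : Fin n} : Ξ k l = 0 ↔ Ξ l k = 0 := by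
  rw [h.strokes_antisymm k l, neg_eq_zero]

theorem trace_ne_one (hm : AdmissibleMasses m) : (limitMatrix ζ Ξ).trace ≠ 1 := by
  classical
  intro htr
  have h1 := htr
  rw [trace_limitMatrix, Nat.cast_eq_one, Finset.card_eq_one] at h1
  obtain ⟨i, hi⟩ := h1
  have hζi : ζ i ≠ 0 := by
    have : i ∈ Finset.univ.filter fun i => ζ i ≠ 0 := by simp [hi]
    simpa using this
  have hζ (l : Fin n) (hl : l ≠ i) : ζ l = 0 :=
    eq_zero_of_trace_eq_card (S := {i}) (by simpa using hζi) (by simpa using htr) (by simpa using hl)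
  have h2 := h.sum_mass_mul_univ
  rw [Finset.sum_eq_single i (fun l _ hl => by rw [hζ l hl, mul_zero]) (by simp)] at h2
  have h3 := hm {i} (Finset.singleton_nonempty i)
  rw [Finset.sum_singleton] at h3
  exact mul_ne_zero h3 hζi h2

/-- If all `z`-strokes join `z`-close bodies then there is no `z`-circle. -/
theorem zeta_eq_zero (hm : AdmissibleMasses m) (hst : ∀ k l, Ξ l k ≠ 0 → ζ k = ζ l) (i : Fin n) :
    ζ i = 0 := by
  classical
  -- No `z`-stroke leaves a class of `z`-close bodies, so the centre of mass of the class vanishes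
  -- to leading order.
  set S := Finset.univ.filter fun k => ζ k = ζ i with hS
  have h1 := h.sum_mass_mul_eq_zero S (fun k hk l hl => by
    by_contra hne
    simp only [hS, Finset.mem_filter, Finset.mem_univ, true_and] at hk hl
    exact hl ((hst k l hne).symm.trans hk))
  rw [Finset.sum_congr rfl (g := fun k => m k * ζ i) (fun k hk => by
    simp only [hS, Finset.mem_filter, Finset.mem_univ, true_and] at hk
    rw [hk]), ← Finset.sum_mul] at h1
  exact (mul_eq_zero.mp h1).resolve_left (hm S ⟨i, by simp [hS]⟩)

theorem trace_limitMatrix_eq_zero (hm : AdmissibleMasses m)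
    (hst : ∀ k l, Ξ l k ≠ 0 → Ω l k ≠ 0) : (limitMatrix ζ Ξ).trace = 0 := by
  classical
  simp [trace_limitMatrix,
    h.zeta_eq_zero hm fun k l hkl => h.eq_of_stroke (hst k l hkl)]

theorem trace_add_eq_zero (hm : AdmissibleMasses m)
    (hne : ∀ i j : Fin n, i < j → (limitMatrix ζ Ξ + limitMatrix ω Ω) i j ≠ 1) :
    (limitMatrix ζ Ξ + limitMatrix ω Ω).trace = 0 := by
  have hlt (i j : Fin n) (hij : i < j) : Ξ i j ≠ 0 ↔ Ω i j ≠ 0 := by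
    rw [← limitMatrix_eq_one (ζ := ζ) hij.ne, ← limitMatrix_eq_one (ζ := ω) hij.ne]
    have h1 := hne i j hij
    rw [Matrix.add_apply] at h1
    rcases limitMatrix_eq_zero_or_one (ζ := ζ) (Ξ := Ξ) i j with h2 | h2 <;>
    rcases limitMatrix_eq_zero_or_one (ζ := ω) (Ξ := Ω) i j with h3 | h3 <;>
    simp_all
  have hiff (i j : Fin n) : Ξ i j ≠ 0 ↔ Ω i j ≠ 0 := by
    rcases lt_trichotomy i j with hij | rfl | hij
    · exact hlt i j hij
    · have h1 := h.strokes_antisymm i i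
      have h2 := h.symm.strokes_antisymm i i
      rw [self_eq_neg] at h1 h2
      simp [h1, h2]
    · rw [Ne, h.stroke_comm, Ne, h.symm.stroke_comm]
      exact hlt j i hij
  rw [Matrix.trace_add, h.trace_limitMatrix_eq_zero hm fun k l => (hiff l k).mp,
    h.symm.trace_limitMatrix_eq_zero hm fun k l => (hiff l k).mpr, add_zero]

theorem zeta_ne_of_pair (hm : AdmissibleMasses m) {i j : Fin n} (hij : i ≠ j)
    (hi : ζ i ≠ 0) (hζ : ∀ l, l ≠ i → l ≠ j → ζ l = 0) : ζ i ≠ ζ j := by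
  intro he
  have h1 := h.sum_mass_mul_univ
  rw [← Finset.sum_subset (Finset.subset_univ {i, j}) (fun l _ hl => by
    simp only [Finset.mem_insert, Finset.mem_singleton, not_or] at hl
    rw [hζ l hl.1 hl.2, mul_zero]), Finset.sum_pair hij, ← he, ← add_mul] at h1
  have h2 := hm {i, j} ⟨i, by simp⟩
  rw [Finset.sum_pair hij] at h2
  exact mul_ne_zero h2 hi h1

theorem isBigO_of_pair (hm : AdmissibleMasses m) {i j : Fin n} (hij : i ≠ j)
    (hi : ζ i ≠ 0) (hζ : ∀ l, l ≠ i → l ≠ j → ζ l = 0) :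
    (fun t => N t * w t i) =O[atTop] fun _ => (1 : ℂ) := by
  refine h.isBigO_mul_of_isolated fun k hk => ?_
  by_cases hkj : k = j
  · rw [hkj]
    exact h.zeta_ne_of_pair hm hij hi hζ
  · rw [hζ k hk hkj]
    exact hi

/-- The stroke bounds `N w_{ki}`; adding `N w_{ij}` bounds `N w_{kj}`, which forces a stroke. -/
theorem stroke_of_stroke {i j k : Fin n} (hjk : j ≠ k) (hζ : ζ k ≠ ζ i)
    (hij : (fun t => N t * (w t i - w t j)) =O[atTop] fun _ => (1 : ℂ)) (hik : Ξ i k ≠ 0) :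
    Ξ j k ≠ 0 := by
  refine h.stroke_of_isBigO hjk.symm ?_
  exact ((h.isBigO_of_stroke hζ hik).add hij).congr_left fun t => by ring

theorem strokes_of_pair (hm : AdmissibleMasses m) {i j : Fin n} (hij : i ≠ j)
    (htr : (limitMatrix ζ Ξ).trace = 2) (hi : limitMatrix ζ Ξ i i = 1)
    (hj : limitMatrix ζ Ξ j j = 1) :
    limitMatrix ζ Ξ i j = 1 ∧
      ∀ k, k ≠ i → k ≠ j → limitMatrix ζ Ξ i k = limitMatrix ζ Ξ j k := by
  rw [limitMatrix_diag_eq_one] at hi hj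
  have hζ (l : Fin n) (hli : l ≠ i) (hlj : l ≠ j) : ζ l = 0 :=
    eq_zero_of_trace_eq_card (S := {i, j}) (by simp [hi, hj])
      (by rw [htr, Finset.card_pair hij]; rfl) (by simp [hli, hlj])
  have hwi := h.isBigO_of_pair hm hij hi hζ
  have hwj := h.isBigO_of_pair hm hij.symm hj fun l hlj hli => hζ l hli hlj
  refine ⟨(limitMatrix_eq_one hij).mpr (h.stroke_of_isBigO hij.symm (isBigO_mul_sub hwj hwi)),
    fun k hki hkj => ?_⟩
  have hiff : Ξ i k ≠ 0 ↔ Ξ j k ≠ 0 :=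
    ⟨h.stroke_of_stroke hkj.symm (by rw [hζ k hki hkj]; exact hi.symm) (isBigO_mul_sub hwi hwj),
      h.stroke_of_stroke hki.symm (by rw [hζ k hki hkj]; exact hj.symm) (isBigO_mul_sub hwj hwi)⟩
  rw [← limitMatrix_eq_one (ζ := ζ) hki.symm, ← limitMatrix_eq_one (ζ := ζ) hkj.symm] at hiff
  rcases limitMatrix_eq_zero_or_one (ζ := ζ) (Ξ := Ξ) i k with h2 | h2 <;>
  rcases limitMatrix_eq_zero_or_one (ζ := ζ) (Ξ := Ξ) j k with h3 | h3 <;>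
  simp_all

theorem dual_row_eq_zero (hm : AdmissibleMasses m) {i j : Fin n} (hij : i ≠ j)
    (hi : ζ i ≠ 0) (hζ : ∀ l, l ≠ i → l ≠ j → ζ l = 0) (k : Fin n) :
    limitMatrix ω Ω i k = 0 := by
  by_cases hik : i = k
  · rw [← hik, limitMatrix_diag_eq_zero]
    exact h.omega_eq_zero_of_isBigO (h.isBigO_of_pair hm hij hi hζ)
  · rw [limitMatrix_eq_zero hik]
    by_contra hΩ
    have he := h.eq_of_stroke hΩ
    by_cases hkj : k = j
    · rw [hkj] at he
      exact h.zeta_ne_of_pair hm hij hi hζ he.symm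
    · rw [hζ k (Ne.symm hik) hkj] at he
      exact hi he.symm

theorem dual_of_isolated_pair (hm : AdmissibleMasses m) {i j : Fin n} (hij : i ≠ j)
    (htr : (limitMatrix ζ Ξ).trace = 2) (hi : limitMatrix ζ Ξ i i = 1)
    (hj : limitMatrix ζ Ξ j j = 1)
    (hst : ∀ k l : Fin n, k ≠ l → ({k, l} : Set (Fin n)) ≠ {i, j} → limitMatrix ζ Ξ k l = 0) :
    (∀ k, limitMatrix ω Ω i k = 0 ∧ limitMatrix ω Ω j k = 0) ∧
      (m i ^ 3 + m j ^ 3 ≠ 0 → (limitMatrix ω Ω).trace ≠ (n : ℤ) - 3) := by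
  classical
  rw [limitMatrix_diag_eq_one] at hi hj
  have hζ (l : Fin n) (hli : l ≠ i) (hlj : l ≠ j) : ζ l = 0 :=
    eq_zero_of_trace_eq_card (S := {i, j}) (by simp [hi, hj])
      (by rw [htr, Finset.card_pair hij]; rfl) (by simp [hli, hlj])
  have hζ' (l : Fin n) (hlj : l ≠ j) (hli : l ≠ i) : ζ l = 0 := hζ l hli hlj
  have hwi := h.isBigO_of_pair hm hij hi hζ
  have hwj := h.isBigO_of_pair hm hij.symm hj hζ'
  have hmass (l : Fin n) : m l ≠ 0 := by
    simpa using hm {l} (Finset.singleton_nonempty l)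
  refine ⟨fun k => ⟨h.dual_row_eq_zero hm hij hi hζ k, h.dual_row_eq_zero hm hij.symm hj hζ' k⟩,
    fun hne htrB => hne ?_⟩
  have hωi := h.omega_eq_zero_of_isBigO hwi
  have hωj := h.omega_eq_zero_of_isBigO hwj
  set T := Finset.univ.filter fun l => ω l = 0 with hT
  -- Trace `n - 3` leaves three bodies with `ω = 0`: `i`, `j` and a single further `k`.
  have hcard : T.card = 3 := by
    have h1 := Finset.card_filter_add_card_filter_not (s := (Finset.univ : Finset (Fin n)))
      (fun l => ω l = 0)
    rw [trace_limitMatrix] at htrB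
    simp only [Finset.card_univ, Fintype.card_fin] at h1
    simp only [hT, ne_eq] at htrB ⊢
    omega
  have hcard' : ((T.erase i).erase j).card = 1 := by
    rw [Finset.card_erase_of_mem (by simp [hT, hωj, hij.symm]),
      Finset.card_erase_of_mem (by simp [hT, hωi]), hcard]
  obtain ⟨k, hk⟩ := Finset.card_eq_one.mp hcard'
  have hmem (l : Fin n) : (l ≠ j ∧ l ≠ i ∧ ω l = 0) ↔ l = k := by
    have h1 : l ∈ (T.erase i).erase j ↔ l ∈ ({k} : Finset (Fin n)) := by rw [hk]
    simpa [hT] using h1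
  obtain ⟨hkj, hki, hωk⟩ := (hmem k).mpr rfl
  have hno {p : Fin n} (hkp : k ≠ p) : Ξ p k = 0 := by
    refine (limitMatrix_eq_zero (ζ := ζ) hkp.symm).mp (hst p k hkp.symm fun he => ?_)
    have h1 : k ∈ ({i, j} : Set (Fin n)) := by
      rw [← he]
      simp
    simp only [Set.mem_insert_iff, Set.mem_singleton_iff] at h1
    exact h1.elim hki hkj
  exact h.mass_cube_add_eq_zero hij hki hkj hi hj hζ hwi hwj (hno hki) (hno hkj) hωk
    (fun l hli hlj hlk hωl => hlk ((hmem l).mp ⟨hlj, hli, hωl⟩)) (hmass k)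

theorem stroke_add_stroke_ne_zero (hm : AdmissibleMasses m) {i j k : Fin n} (hij : i ≠ j)
    (hik : i ≠ k) (hjk : j ≠ k) (htr : (limitMatrix ζ Ξ).trace = 3)
    (hi : limitMatrix ζ Ξ i i = 1) (hj : limitMatrix ζ Ξ j j = 1) (hk : limitMatrix ζ Ξ k k = 1)
    {l : Fin n} (hli : l ≠ i) (hlj : l ≠ j) (hlk : l ≠ k) (hsij : limitMatrix ζ Ξ i j = 1)
    (hsik : limitMatrix ζ Ξ i k = 1) (hsil : limitMatrix ζ Ξ i l = 1) :
    limitMatrix ζ Ξ j l + limitMatrix ζ Ξ k l ≠ 0 := by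
  intro hsum
  have hzero : limitMatrix ζ Ξ j l = 0 ∧ limitMatrix ζ Ξ k l = 0 := by
    rcases limitMatrix_eq_zero_or_one (ζ := ζ) (Ξ := Ξ) j l with h2 | h2 <;>
    rcases limitMatrix_eq_zero_or_one (ζ := ζ) (Ξ := Ξ) k l with h3 | h3 <;>
    simp_all
  rw [limitMatrix_eq_zero hlj.symm, limitMatrix_eq_zero hlk.symm] at hzero
  rw [limitMatrix_diag_eq_one] at hi hj hk
  rw [limitMatrix_eq_one hij] at hsij
  rw [limitMatrix_eq_one hik] at hsik
  rw [limitMatrix_eq_one hli.symm] at hsil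
  have hcard : ({i, j, k} : Finset (Fin n)).card = 3 := by
    rw [Finset.card_eq_three]
    exact ⟨i, j, k, hij, hik, hjk, rfl⟩
  have hζ (p : Fin n) (hp : p ∉ ({i, j, k} : Finset (Fin n))) : ζ p = 0 :=
    eq_zero_of_trace_eq_card (by simp [hi, hj, hk]) (by rw [htr, hcard]; rfl) hp
  have hζl : ζ l ≠ ζ i := by
    rw [hζ l (by simp [hli, hlj, hlk])]
    exact hi.symm
  -- If `p` were not `z`-close to `i`, the stroke between them would bound `N w_{ip}` and carry the
  -- stroke `il` over to `pl`.
  have hclose {p : Fin n} (hlp : p ≠ l) (hs : Ξ i p ≠ 0) (hp : Ξ p l = 0) : ζ p = ζ i := by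
    by_contra hne
    refine h.stroke_of_stroke hlp hζl ?_ hsil hp
    exact (h.isBigO_of_stroke hne hs).neg_left.congr_left fun t => by ring
  have h2 := h.sum_mass_mul_univ
  rw [← Finset.sum_subset (Finset.subset_univ {i, j, k}) (fun p _ hp => by
      rw [hζ p hp, mul_zero]),
    Finset.sum_congr rfl (g := fun p => m p * ζ i) (fun p hp => by
      simp only [Finset.mem_insert, Finset.mem_singleton] at hp
      rcases hp with rfl | rfl | rfl
      · rfl
      · rw [hclose hlj.symm hsij hzero.1]
      · rw [hclose hlk.symm hsik hzero.2]), ← Finset.sum_mul] at h2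
  exact mul_ne_zero (hm {i, j, k} ⟨i, by simp⟩) hi h2

theorem matrix_rules (hm : AdmissibleMasses m) (A B : Matrix (Fin n) (Fin n) ℤ)
    (hA : A = limitMatrix ζ Ξ) (hB : B = limitMatrix ω Ω) :
    A.trace ≠ 1 ∧
    ((∀ i j : Fin n, i < j → (A + B) i j ≠ 1) → (A + B).trace = 0) ∧
    (∀ i j : Fin n, i ≠ j → A.trace = 2 → A i i = 1 → A j j = 1 →
      A i j = 1 ∧ ∀ k : Fin n, k ≠ i → k ≠ j → A i k = A j k) ∧
    (∀ i j : Fin n, i ≠ j → A.trace = 2 → A i i = 1 → A j j = 1 →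
      (∀ k l : Fin n, k ≠ l → ({k, l} : Set (Fin n)) ≠ {i, j} → A k l = 0) →
      (∀ k : Fin n, B i k = 0 ∧ B j k = 0) ∧
      (m i ^ 3 + m j ^ 3 ≠ 0 → B.trace ≠ (n : ℤ) - 3)) ∧
    (∀ i j k : Fin n, i ≠ j → i ≠ k → j ≠ k → A.trace = 3 →
      A i i = 1 → A j j = 1 → A k k = 1 →
      ∀ l : Fin n, l ≠ i → l ≠ j → l ≠ k → A i j = 1 → A i k = 1 → A i l = 1 →
        A j l + A k l ≠ 0) := by
  subst hA hB
  exact ⟨h.trace_ne_one hm, h.trace_add_eq_zero hm, fun i j hij => h.strokes_of_pair hm hij,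
    fun i j hij => h.dual_of_isolated_pair hm hij,
    fun i j k hij hik hjk htr hi hj hk l hli hlj hlk =>
      h.stroke_add_stroke_ne_zero hm hij hik hjk htr hi hj hk hli hlj hlk⟩

end BalancedLimit

/-! ### From singular sequences to balanced limits. -/

theorem isTheta_iff_of_tendsto_div {f : ℕ → ℂ} {g : ℕ → ℝ} {c : ℂ} (hg : ∀ t, g t ≠ 0)
    (h : Tendsto (fun t => f t / (g t : ℂ)) atTop (𝓝 c)) : f =Θ[atTop] g ↔ c ≠ 0 := by
  have hg' (t : ℕ) : (g t : ℂ) ≠ 0 := Complex.ofReal_ne_zero.mpr (hg t)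
  rw [← Complex.isTheta_ofReal_right]
  refine ⟨fun hfg hc => ?_, fun hc => ?_⟩
  · rw [hc] at h
    have h1 : f =o[atTop] fun t => (g t : ℂ) :=
      (isLittleO_iff_tendsto fun t ht => absurd ht (hg' t)).mpr h
    have h2 := (hfg.2.trans_isLittleO h1)
    have h3 := (isLittleO_iff_tendsto fun t ht => absurd ht (hg' t)).mp h2
    simp only [div_self (hg' _)] at h3
    exact one_ne_zero (tendsto_nhds_unique tendsto_const_nhds h3)
  · refine ⟨?_, ?_⟩
    · refine ((h.isBigO_one ℂ).mul (isBigO_refl (fun t => (g t : ℂ)) atTop)).congr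
        (fun t => div_mul_cancel₀ _ (hg' t)) (fun t => one_mul _)
    · have h1 := h.inv₀ hc
      refine ((h1.isBigO_one ℂ).mul (isBigO_refl f atTop)).congr' ?_ (.of_forall fun t => one_mul _)
      filter_upwards [h.eventually_ne hc] with t ht
      have hf : f t ≠ 0 := fun h0 => ht (by rw [h0, zero_div])
      field_simp

namespace Configuration

variable {n : ℕ} (Q : Configuration n)

/-- The common value of the norms of the two vectors in the balanced normalization. -/
noncomputable def commonNorm : ℝ := Real.sqrt (‖Q.zVec‖ * ‖Q.wVec‖)

theorem eps_zpow : Q.eps ^ (-2 : ℤ) = Q.commonNorm := by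
  have h0 : 0 ≤ ‖Q.zVec‖ * ‖Q.wVec‖ := by positivity
  rw [eps, commonNorm, ← Real.rpow_intCast, ← Real.rpow_mul h0, Real.sqrt_eq_rpow]
  norm_num

/-- Balancing cancels on division by the common norm, so the convergence assumed of the normalized
vectors applies directly. -/
theorem scale_mul_div (hz : 0 < ‖Q.zVec‖) (hw : 0 < ‖Q.wVec‖) (u : ℂ) :
    Q.scale * u / Q.commonNorm = (‖Q.zVec‖ : ℂ)⁻¹ * u := by
  have h1 : Q.commonNorm = Q.scale * ‖Q.zVec‖ := by
    rw [commonNorm, scale, ← Real.sqrt_sq hz.le, ← Real.sqrt_mul (by positivity),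
      Real.sqrt_sq hz.le]
    congr 1
    field_simp
  have h2 : (Q.scale : ℂ) ≠ 0 := by
    rw [Complex.ofReal_ne_zero, scale]
    positivity
  rw [h1, Complex.ofReal_mul]
  field_simp

theorem scale_inv_mul_div (hz : 0 < ‖Q.zVec‖) (hw : 0 < ‖Q.wVec‖) (u : ℂ) :
    (Q.scale : ℂ)⁻¹ * u / Q.commonNorm = (‖Q.wVec‖ : ℂ)⁻¹ * u := by
  have h1 : Q.scale * Q.commonNorm = ‖Q.wVec‖ := by
    rw [commonNorm, scale, ← Real.sqrt_mul (by positivity)]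
    rw [show ‖Q.wVec‖ / ‖Q.zVec‖ * (‖Q.zVec‖ * ‖Q.wVec‖) = ‖Q.wVec‖ ^ 2 by field_simp,
      Real.sqrt_sq hw.le]
  rw [← h1, Complex.ofReal_mul, mul_inv]
  ring

theorem norm_zVec_ge_z (k : Fin n) : ‖Q.z k‖ ≤ ‖Q.zVec‖ := norm_le_pi_norm Q.zVec (Sum.inl k)

theorem norm_wVec_ge_w (k : Fin n) : ‖Q.w k‖ ≤ ‖Q.wVec‖ := norm_le_pi_norm Q.wVec (Sum.inl k)

theorem norm_zVec_ge_Z {k l : Fin n} (h : k < l) : ‖Q.Z k l‖ ≤ ‖Q.zVec‖ :=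
  norm_le_pi_norm Q.zVec (Sum.inr ⟨(k, l), h⟩)

theorem norm_wVec_ge_W {k l : Fin n} (h : k < l) : ‖Q.W k l‖ ≤ ‖Q.wVec‖ :=
  norm_le_pi_norm Q.wVec (Sum.inr ⟨(k, l), h⟩)

theorem Z_swap (k l : Fin n) : Q.Z l k = -Q.Z k l := by
  rw [Z, Z, Sym2.eq_swap]
  ring

theorem W_swap (k l : Fin n) : Q.W l k = -Q.W k l := by
  rw [W, W, Sym2.eq_swap]
  ring

end Configuration

namespace IsNormalizedCC

variable {n : ℕ} {m : Fin n → ℂ} {Q : Configuration n}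

theorem eq_z (h : IsNormalizedCC m Q) (k : Fin n) :
    Q.z k = ∑ l, m l * (Q.δ s(l, k) ^ 3 * (Q.z k - Q.z l)) := by
  rw [← Finset.add_sum_erase _ _ (Finset.mem_univ k), sub_self, mul_zero, mul_zero, zero_add]
  conv_lhs => rw [Configuration.z, h.eq_x k, h.eq_y k, Finset.mul_sum, ← Finset.sum_add_distrib]
  exact Finset.sum_congr rfl fun l _ => by simp only [Configuration.z]; ring

theorem eq_w (h : IsNormalizedCC m Q) (k : Fin n) :
    Q.w k = ∑ l, m l * (Q.δ s(l, k) ^ 3 * (Q.w k - Q.w l)) := by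
  rw [← Finset.add_sum_erase _ _ (Finset.mem_univ k), sub_self, mul_zero, mul_zero, zero_add]
  conv_lhs => rw [Configuration.w, h.eq_x k, h.eq_y k, Finset.mul_sum, ← Finset.sum_sub_distrib]
  exact Finset.sum_congr rfl fun l _ => by simp only [Configuration.w]; ring

theorem eq_mul (h : IsNormalizedCC m Q) {k l : Fin n} (hkl : k ≠ l) :
    Q.δ s(l, k) ^ 2 * ((Q.z k - Q.z l) * (Q.w k - Q.w l)) = 1 := by
  have hzw : (Q.z k - Q.z l) * (Q.w k - Q.w l) = (Q.x k - Q.x l) ^ 2 + (Q.y k - Q.y l) ^ 2 := by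
    simp only [Configuration.z, Configuration.w]
    linear_combination (-(Q.y k - Q.y l) ^ 2) * Complex.I_sq
  rw [hzw]
  rcases lt_or_gt_of_ne hkl with hlt | hlt
  · rw [Sym2.eq_swap, ← h.eq_δ k l hlt]
  · rw [h.eq_δ l k hlt]
    ring

/-- As `‖δ‖ ‖D‖ = 1`, the second bound reads `‖δ‖² ≤ v`, whence `1 ≤ v (2v)² = 4v³`; the constant
`1/2` is not optimal. -/
theorem half_le_of_bounds {δ D : ℂ} {v : ℝ} (h : δ ^ 2 * (D * D) = 1) (h1 : ‖D‖ ≤ 2 * v)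
    (h2 : ‖δ ^ 3 * D‖ ≤ v) : 1 / 2 ≤ v := by
  have h3 : ‖δ‖ * ‖D‖ = 1 := by
    have h4 : (‖δ‖ * ‖D‖) ^ 2 = 1 := by
      rw [← norm_mul, ← norm_pow, mul_pow, sq D, h, norm_one]
    exact (pow_eq_one_iff_of_nonneg (by positivity) two_ne_zero).mp h4
  have h5 : ‖δ‖ ^ 2 ≤ v := by
    rw [norm_mul, norm_pow] at h2
    calc ‖δ‖ ^ 2 = ‖δ‖ ^ 2 * (‖δ‖ * ‖D‖) := by rw [h3, mul_one]
      _ = ‖δ‖ ^ 3 * ‖D‖ := by ring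
      _ ≤ v := h2
  have hv : 0 ≤ v := (sq_nonneg _).trans h5
  by_contra! hlt
  have h6 : (1 : ℝ) ≤ v * (2 * v) ^ 2 := by
    calc (1 : ℝ) = ‖δ‖ ^ 2 * ‖D‖ ^ 2 := by rw [← mul_pow, h3, one_pow]
      _ ≤ v * (2 * v) ^ 2 := by gcongr
  have h7 : v * (2 * v) ^ 2 ≤ 1 / 2 * 1 ^ 2 := by
    gcongr
    linarith
  norm_num at h7
  linarith

/-- The normalization `y_1 = y_2` makes `z_{12} = w_{12}`, so neither vector can become small while
the other grows. -/
theorem half_le_norm (h : IsNormalizedCC m Q) (hn : 2 ≤ n) :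
    1 / 2 ≤ ‖Q.zVec‖ ∧ 1 / 2 ≤ ‖Q.wVec‖ := by
  set a : Fin n := ⟨0, by omega⟩
  set b : Fin n := ⟨1, by omega⟩
  have hab : a < b := by simp [a, b, Fin.lt_def]
  have hy : Q.y b - Q.y a = 0 := h.eq_rot a b rfl rfl
  have hz : Q.z b - Q.z a = Q.x b - Q.x a := by
    simp only [Configuration.z]
    linear_combination Complex.I * hy
  have hw : Q.w b - Q.w a = Q.x b - Q.x a := by
    simp only [Configuration.w]
    linear_combination -Complex.I * hy
  have hd := h.eq_mul hab.ne'
  rw [hz, hw] at hd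
  have h1 := norm_sub_le (Q.z b) (Q.z a)
  have h2 := norm_sub_le (Q.w b) (Q.w a)
  have h3 := Q.norm_zVec_ge_Z hab
  have h4 := Q.norm_wVec_ge_W hab
  rw [Configuration.Z, hz] at h3
  rw [Configuration.W, hw] at h4
  rw [hz] at h1
  rw [hw] at h2
  have h5 := Q.norm_zVec_ge_z a
  have h6 := Q.norm_zVec_ge_z b
  have h7 := Q.norm_wVec_ge_w a
  have h8 := Q.norm_wVec_ge_w b
  exact ⟨half_le_of_bounds hd (by linarith) h3, half_le_of_bounds hd (by linarith) h4⟩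

theorem vec_eq_zero [Subsingleton (Fin n)] (h : IsNormalizedCC m Q) :
    Q.zVec = 0 ∧ Q.wVec = 0 := by
  have hz (k : Fin n) : Q.z k = 0 := by
    rw [h.eq_z k]
    exact Finset.sum_eq_zero fun l _ => by rw [Subsingleton.elim l k]; ring
  have hw (k : Fin n) : Q.w k = 0 := by
    rw [h.eq_w k]
    exact Finset.sum_eq_zero fun l _ => by rw [Subsingleton.elim l k]; ring
  constructor
  · funext p
    rcases p with k | p
    · exact hz k
    · exact absurd (Subsingleton.elim _ _) p.2.ne
  · funext p
    rcases p with k | p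
    · exact hw k
    · exact absurd (Subsingleton.elim _ _) p.2.ne

end IsNormalizedCC

theorem exists_tendsto_of_antisymm {n : ℕ} {f : ℕ → Fin n → Fin n → ℂ}
    (hf : ∀ t k l, f t l k = -f t k l)
    (hlim : ∀ k l, k < l → ∃ c, Tendsto (fun t => f t k l) atTop (𝓝 c)) (k l : Fin n) :
    ∃ c, Tendsto (fun t => f t k l) atTop (𝓝 c) := by
  rcases lt_trichotomy k l with hkl | rfl | hkl
  · exact hlim k l hkl
  · refine ⟨0, tendsto_const_nhds.congr fun t => ?_⟩
    exact (self_eq_neg.mp (hf t k k)).symm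
  · obtain ⟨c, hc⟩ := hlim l k hkl
    exact ⟨-c, hc.neg.congr fun t => (hf t l k).symm⟩

namespace IsSingularSequence

variable {n : ℕ} {m : Fin n → ℂ} {Q : ℕ → Configuration n}

theorem two_le (h : IsSingularSequence m Q) : 2 ≤ n := by
  by_contra! hn
  have : Subsingleton (Fin n) := Fin.subsingleton_iff_le_one.mpr (by omega)
  have hb : Bornology.IsBounded ({0} : Set (VecIndex n → ℂ)) := Bornology.isBounded_singleton
  rcases h.unbounded with hu | hu
  · refine hu (hb.subset ?_)
    rintro _ ⟨t, rfl⟩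
    exact (h.isNormalizedCC t).vec_eq_zero.1
  · refine hu (hb.subset ?_)
    rintro _ ⟨t, rfl⟩
    exact (h.isNormalizedCC t).vec_eq_zero.2

theorem half_le_norm (h : IsSingularSequence m Q) (t : ℕ) :
    1 / 2 ≤ ‖(Q t).zVec‖ ∧ 1 / 2 ≤ ‖(Q t).wVec‖ := (h.isNormalizedCC t).half_le_norm h.two_le

theorem norm_zVec_pos (h : IsSingularSequence m Q) (t : ℕ) : 0 < ‖(Q t).zVec‖ := by
  linarith [(h.half_le_norm t).1]

theorem norm_wVec_pos (h : IsSingularSequence m Q) (t : ℕ) : 0 < ‖(Q t).wVec‖ := by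
  linarith [(h.half_le_norm t).2]

theorem commonNorm_pos (h : IsSingularSequence m Q) (t : ℕ) : 0 < (Q t).commonNorm :=
  Real.sqrt_pos.mpr (mul_pos (h.norm_zVec_pos t) (h.norm_wVec_pos t))

/-- One norm is unbounded and the other is at least `1/2`, so their product is unbounded. -/
theorem not_bddAbove_commonNorm (h : IsSingularSequence m Q) :
    ¬ BddAbove (Set.range fun t => (Q t).commonNorm) := by
  rintro ⟨C, hC⟩
  have hle (t : ℕ) : ‖(Q t).zVec‖ * ‖(Q t).wVec‖ ≤ C ^ 2 :=
    (Real.sqrt_le_left ((h.commonNorm_pos t).le.trans (hC ⟨t, rfl⟩))).mp (hC ⟨t, rfl⟩)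
  rcases h.unbounded with hu | hu
  · refine hu (isBounded_iff_forall_norm_le.mpr ⟨2 * C ^ 2, ?_⟩)
    rintro _ ⟨t, rfl⟩
    nlinarith [hle t, (h.half_le_norm t).2, h.norm_zVec_pos t]
  · refine hu (isBounded_iff_forall_norm_le.mpr ⟨2 * C ^ 2, ?_⟩)
    rintro _ ⟨t, rfl⟩
    nlinarith [hle t, (h.half_le_norm t).1, h.norm_wVec_pos t]

theorem exists_subseq (h : IsSingularSequence m Q) :
    ∃ φ : ℕ → ℕ, StrictMono φ ∧ Tendsto (fun t => (Q (φ t)).commonNorm) atTop atTop := by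
  obtain ⟨φ, hφ, hle⟩ := extraction_forall_of_frequently
    (P := fun c t => (c : ℝ) ≤ (Q t).commonNorm) (fun c => by
      by_contra hc
      rw [not_frequently] at hc
      refine h.not_bddAbove_commonNorm (IsBoundedUnder.bddAbove_range ⟨c, ?_⟩)
      rw [eventually_map]
      exact hc.mono fun t ht => (not_le.mp ht).le)
  exact ⟨φ, hφ, tendsto_atTop_mono hle tendsto_natCast_atTop_atTop⟩

theorem exists_lim_z (h : IsSingularSequence m Q) (p : VecIndex n) :
    ∃ c, Tendsto (fun t => (Q t).scale * (Q t).zVec p / (Q t).commonNorm) atTop (𝓝 c) := by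
  obtain ⟨v, hv⟩ := h.conv_z
  refine ⟨v p, ((tendsto_pi_nhds.mp hv) p).congr fun t => ?_⟩
  rw [(Q t).scale_mul_div (h.norm_zVec_pos t) (h.norm_wVec_pos t), Pi.smul_apply,
    Complex.real_smul, Complex.ofReal_inv]

theorem exists_lim_w (h : IsSingularSequence m Q) (p : VecIndex n) :
    ∃ c, Tendsto (fun t => ((Q t).scale : ℂ)⁻¹ * (Q t).wVec p / (Q t).commonNorm)
      atTop (𝓝 c) := by
  obtain ⟨v, hv⟩ := h.conv_w
  refine ⟨v p, ((tendsto_pi_nhds.mp hv) p).congr fun t => ?_⟩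
  rw [(Q t).scale_inv_mul_div (h.norm_zVec_pos t) (h.norm_wVec_pos t), Pi.smul_apply,
    Complex.real_smul, Complex.ofReal_inv]

theorem isTheta_iff (h : IsSingularSequence m Q) {u : ℕ → ℂ} {s : ℕ → ℝ} {c : ℂ}
    (hu : Tendsto (fun t => s t * u t / (Q t).commonNorm) atTop (𝓝 c)) :
    ((fun t => s t • u t) =Θ[atTop] fun t => (Q t).eps ^ (-2 : ℤ)) ↔ c ≠ 0 := by
  simp only [Configuration.eps_zpow, Complex.real_smul]
  exact isTheta_iff_of_tendsto_div (fun t => (h.commonNorm_pos t).ne') hu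

/-- A subsequence of a singular sequence is a balanced sequence whose limits determine the `z`- and
`w`-matrices. -/
theorem exists_balancedLimit (h : IsSingularSequence m Q) :
    ∃ N z w d ζ ω Ξ Ω, BalancedLimit m N z w d ζ ω Ξ Ω ∧
      zMatrix Q = limitMatrix ζ Ξ ∧ wMatrix Q = limitMatrix ω Ω := by
  choose ζ hζ using fun k => h.exists_lim_z (Sum.inl k)
  choose ω hω using fun k => h.exists_lim_w (Sum.inl k)
  have hΞ' := exists_tendsto_of_antisymm
    (f := fun t l k => (Q t).scale * (Q t).Z l k / (Q t).commonNorm)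
    (fun t k l => by rw [(Q t).Z_swap k l]; ring)
    (fun k l hkl => h.exists_lim_z (Sum.inr ⟨(k, l), hkl⟩))
  have hΩ' := exists_tendsto_of_antisymm
    (f := fun t l k => ((Q t).scale : ℂ)⁻¹ * (Q t).W l k / (Q t).commonNorm)
    (fun t k l => by rw [(Q t).W_swap k l]; ring)
    (fun k l hkl => h.exists_lim_w (Sum.inr ⟨(k, l), hkl⟩))
  choose Ξ hΞ using hΞ'
  choose Ω hΩ using hΩ'
  -- The limits exist along the whole sequence and determine its matrices; the subsequence serves
  -- only to make the common norm tend to infinity.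
  obtain ⟨φ, hφ, hN⟩ := h.exists_subseq
  have hφ' := hφ.tendsto_atTop
  refine ⟨fun t => (Q (φ t)).commonNorm, fun t k => (Q (φ t)).scale * (Q (φ t)).z k,
    fun t k => ((Q (φ t)).scale : ℂ)⁻¹ * (Q (φ t)).w k, fun t l k => (Q (φ t)).δ s(l, k),
    ζ, ω, Ξ, Ω, ⟨?_, ?_, ?_, ?_, ?_, ?_, ?_, ?_, ?_⟩, ?_, ?_⟩
  · rw [← tendsto_norm_atTop_iff_cobounded]
    refine hN.congr fun t => ?_
    rw [Complex.norm_real, Real.norm_of_nonneg (h.commonNorm_pos _).le]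
  · intro t k l
    rw [Sym2.eq_swap]
  · intro t k
    conv_lhs => rw [(h.isNormalizedCC (φ t)).eq_z k, Finset.mul_sum]
    exact Finset.sum_congr rfl fun l _ => by ring
  · intro t k
    conv_lhs => rw [(h.isNormalizedCC (φ t)).eq_w k, Finset.mul_sum]
    exact Finset.sum_congr rfl fun l _ => by ring
  · intro t k l hkl
    have hs : ((Q (φ t)).scale : ℂ) ≠ 0 := by
      have hz := h.norm_zVec_pos (φ t)
      have hw := h.norm_wVec_pos (φ t)
      rw [Complex.ofReal_ne_zero, Configuration.scale]
      positivity
    rw [← (h.isNormalizedCC (φ t)).eq_mul hkl]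
    field_simp
  · exact fun k => (hζ k).comp hφ'
  · exact fun k => (hω k).comp hφ'
  · refine fun l k => ((hΞ l k).comp hφ').congr fun t => ?_
    simp only [Function.comp_apply, Configuration.Z]
    ring
  · refine fun l k => ((hΩ l k).comp hφ').congr fun t => ?_
    simp only [Function.comp_apply, Configuration.W]
    ring
  · ext i j
    have h1 : ZCircle Q i ↔ ζ i ≠ 0 := h.isTheta_iff (hζ i)
    have h2 : ZStroke Q i j ↔ Ξ i j ≠ 0 := h.isTheta_iff (hΞ i j)
    simp only [zMatrix, limitMatrix, Matrix.of_apply, h1, h2]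
  · ext i j
    have h1 : WCircle Q i ↔ ω i ≠ 0 :=
      h.isTheta_iff (s := fun t => (Q t).scale⁻¹) (by simp only [Complex.ofReal_inv]; exact hω i)
    have h2 : WStroke Q i j ↔ Ω i j ≠ 0 :=
      h.isTheta_iff (s := fun t => (Q t).scale⁻¹) (by simp only [Complex.ofReal_inv]; exact hΩ i j)
    simp only [wMatrix, limitMatrix, Matrix.of_apply, h1, h2]

end IsSingularSequence

end PlanarNBody

theorem mainTheorem2 {n : ℕ} (m : Fin n → ℂ) (hm : PlanarNBody.AdmissibleMasses m)
    (Q : ℕ → PlanarNBody.Configuration n) (hQ : PlanarNBody.IsSingularSequence m Q)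
    (A B : Matrix (Fin n) (Fin n) ℤ)
    (hAB : (A = PlanarNBody.zMatrix Q ∧ B = PlanarNBody.wMatrix Q) ∨
      (A = PlanarNBody.wMatrix Q ∧ B = PlanarNBody.zMatrix Q)) :
    A.trace ≠ 1 ∧
    ((∀ i j : Fin n, i < j → (A + B) i j ≠ 1) → (A + B).trace = 0) ∧
    (∀ i j : Fin n, i ≠ j → A.trace = 2 → A i i = 1 → A j j = 1 →
      A i j = 1 ∧ ∀ k : Fin n, k ≠ i → k ≠ j → A i k = A j k) ∧
    (∀ i j : Fin n, i ≠ j → A.trace = 2 → A i i = 1 → A j j = 1 →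
      (∀ k l : Fin n, k ≠ l → ({k, l} : Set (Fin n)) ≠ {i, j} → A k l = 0) →
      (∀ k : Fin n, B i k = 0 ∧ B j k = 0) ∧
      (m i ^ 3 + m j ^ 3 ≠ 0 → B.trace ≠ (n : ℤ) - 3)) ∧
    (∀ i j k : Fin n, i ≠ j → i ≠ k → j ≠ k → A.trace = 3 →
      A i i = 1 → A j j = 1 → A k k = 1 →
      ∀ l : Fin n, l ≠ i → l ≠ j → l ≠ k → A i j = 1 → A i k = 1 → A i l = 1 →
        A j l + A k l ≠ 0) := by
  obtain ⟨N, z, w, d, ζ, ω, Ξ, Ω, h, hz, hw⟩ := hQ.exists_balancedLimit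
  rcases hAB with ⟨hA, hB⟩ | ⟨hA, hB⟩
  · exact h.matrix_rules hm A B (hA.trans hz) (hB.trans hw)
  · exact h.symm.matrix_rules hm A B (hA.trans hw) (hB.trans hz)
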